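/- Let $\mathcal A$ be a complex Banach algebra (not assumed to have a unit). Then (a) $\mathcal A$ is boundedly approximately contractible if and only if $\mathcal A$ is boundedly pseudo-amenable and has a bounded approximate identity; (b) $\mathcal A$ is sequentially approximately contractible if and only if $\mathcal A$ is sequentially pseudo-amenable and has a bounded approximate identity. Here the terms are as follows. For a Banach $\mathcal A$-bimodule $X$ and $x\in X$ let $ad_x\colon \mathcal A\to X$, $ad_x(a)=ax-xa$. $\mathcal A$ is boundedly (resp. sequentially) approximately contractible if, for every Banach $\mathcal A$-bimodule $X$ and every continuous linear derivation $D\colon\mathcal A\to X$ (that is, $D(ab)=aD(b)+D(a)b$), there is a net $(x_i)\subset X$ for which $(ad_{x_i})$ is bounded in operator norm (resp. a sequence $(x_i)\subset X$) such that $D(a)=\lim_i ad_{x_i}(a)$ in norm for each $a\in\mathcal A$. Let $\mathcal A\hat\otimes\mathcal A$ be the projective tensor product with the bimodule actions $a(b\otimes c)=ab\otimes c$ and $(b\otimes c)a=b\otimes ca$, and let $\pi\colon\mathcal A\hat\otimes\mathcal A\to\mathcal A$ be the bounded linear map with $\pi(a\otimes b)=ab$. An approximate diagonal for $\mathcal A$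 is a net $(u_i)\subset\mathcal A\hat\otimes\mathcal A$ such that $au_i-u_ia\to0$ and $\pi(u_i)a\to a$ in norm for all $a\in\mathcal A$. $\mathcal A$ is boundedly pseudo-amenable if it has an approximate diagonal $(u_i)$ for which there is a constant $K>0$ with $\|au_i-u_ia\|\le K\|a\|$ and $\|\pi(u_i)a\|\le K\|a\|$ for all $i$ and all $a\in\mathcal A$; it is sequentially pseudo-amenable if it has an approximate diagonal that is a sequence. A bounded approximate identity is a norm-bounded net $(e_i)\subset\mathcal A$ such that $e_ia\to a$ and $ae_i\to a$ in norm for all $a\in\mathcal A$. -/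

import Mathlib

open Filter Topology
open scoped TensorProduct

universe u

noncomputable section

/-! ### The projective tensor product -/

/-- The projective tensor product of a Banach space `E` with itself: the completion of the
algebraic tensor product (of the family indexed by `Fin 2` with constant value `E`) in the
projective norm, which is the norm that Mathlib puts on `PiTensorProduct`. -/
abbrev ProjTensor (E : Type*) [NormedAddCommGroup E] [NormedSpace ℂ E] :=
  UniformSpace.Completion (⨂[ℂ] _ : Fin 2, E)

namespace ProjTensor

section Space

variable {E F : Type*} [NormedAddCommGroup E] [NormedSpace ℂ E]
  [NormedAddCommGroup F] [NormedSpace ℂ F]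

/-- A bounded bilinear map as a continuous multilinear map on `Fin 2`. -/
def toMultilinear (B : E →L[ℂ] E →L[ℂ] F) : ContinuousMultilinearMap ℂ (fun _ : Fin 2 => E) F :=
  MultilinearMap.mkContinuous
    { toFun := fun m => B (m 0) (m 1)
      map_update_add' := by
        intro _ m i x y
        fin_cases i <;> simp [Function.update]
      map_update_smul' := by
        intro _ m i c x
        fin_cases i <;> simp [Function.update] }
    ‖B‖ (by
      intro m
      simpa [Fin.prod_univ_two, mul_assoc] using B.le_opNorm₂ (m 0) (m 1))

/-- The elementary tensor `x ⊗ y`. -/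
def tmul (x y : E) : ProjTensor E :=
  ((PiTensorProduct.tprod ℂ ![x, y] : ⨂[ℂ] _ : Fin 2, E) : ProjTensor E)

/-- The bounded linear map on the projective tensor product determined by a bounded bilinear map,
characterized by `lift_tmul`. -/
def lift [CompleteSpace F] (B : E →L[ℂ] E →L[ℂ] F) : ProjTensor E →L[ℂ] F :=
  (PiTensorProduct.liftIsometry ℂ (fun _ : Fin 2 => E) F (toMultilinear B)).extend
    UniformSpace.Completion.toComplL

theorem lift_coe [CompleteSpace F] (B : E →L[ℂ] E →L[ℂ] F) (t : ⨂[ℂ] _ : Fin 2, E) :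
    lift B (t : ProjTensor E)
      = PiTensorProduct.liftIsometry ℂ (fun _ : Fin 2 => E) F (toMultilinear B) t :=
  ContinuousLinearMap.extend_eq
    (e := (UniformSpace.Completion.toComplL : (⨂[ℂ] _ : Fin 2, E) →L[ℂ] ProjTensor E)) _
    UniformSpace.Completion.denseRange_coe
    (UniformSpace.Completion.isUniformInducing_coe _) t

theorem lift_tmul [CompleteSpace F] (B : E →L[ℂ] E →L[ℂ] F) (x y : E) :
    lift B (tmul x y) = B x y := by
  rw [tmul, lift_coe, PiTensorProduct.liftIsometry_apply_apply]
  simp [toMultilinear]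

theorem norm_tmul_le (x y : E) : ‖tmul x y‖ ≤ ‖x‖ * ‖y‖ := by
  rw [tmul, UniformSpace.Completion.norm_coe]
  simpa [Fin.prod_univ_two] using
    PiTensorProduct.projectiveSeminorm_tprod_le (𝕜 := ℂ) (E := fun _ : Fin 2 => E) ![x, y]

/-- The bounded bilinear map `(x, y) ↦ x ⊗ y`. -/
def tmulL : E →L[ℂ] E →L[ℂ] ProjTensor E :=
  LinearMap.mkContinuous₂
    (LinearMap.mk₂ ℂ tmul
      (fun x x' y => by
        have h := (PiTensorProduct.tprod ℂ (s := fun _ : Fin 2 => E)).map_update_add ![x, y] 0 x x'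
        have e : ∀ z : E, Function.update ![x, y] 0 z = ![z, y] := by
          intro z; ext i; fin_cases i <;> simp
        simp only [e] at h
        simp only [tmul]
        rw [← UniformSpace.Completion.coe_add, ← h])
      (fun c x y => by
        have h := (PiTensorProduct.tprod ℂ (s := fun _ : Fin 2 => E)).map_update_smul ![x, y] 0 c x
        have e : ∀ z : E, Function.update ![x, y] 0 z = ![z, y] := by
          intro z; ext i; fin_cases i <;> simp
        simp only [e] at h
        simp only [tmul]
        rw [← UniformSpace.Completion.coe_smul, ← h])
      (fun x y y' => by
        have h := (PiTensorProduct.tprod ℂ (s := fun _ : Fin 2 => E)).map_update_add ![x, y] 1 y y'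
        have e : ∀ z : E, Function.update ![x, y] 1 z = ![x, z] := by
          intro z; ext i; fin_cases i <;> simp
        simp only [e] at h
        simp only [tmul]
        rw [← UniformSpace.Completion.coe_add, ← h])
      (fun c x y => by
        have h := (PiTensorProduct.tprod ℂ (s := fun _ : Fin 2 => E)).map_update_smul ![x, y] 1 c y
        have e : ∀ z : E, Function.update ![x, y] 1 z = ![x, z] := by
          intro z; ext i; fin_cases i <;> simp
        simp only [e] at h
        simp only [tmul]
        rw [← UniformSpace.Completion.coe_smul, ← h]))
    1 (by intro x y; simpa using norm_tmul_le x y)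

theorem tmulL_apply (x y : E) : tmulL x y = tmul x y := rfl

end Space

section Algebra

variable {A : Type*} [NonUnitalNormedRing A] [NormedSpace ℂ A] [IsScalarTower ℂ A A]
  [SMulCommClass ℂ A A]

/-- The left module action `a · (x ⊗ y) = (a x) ⊗ y`. -/
def leftMul (a : A) : ProjTensor A →L[ℂ] ProjTensor A :=
  lift (tmulL.comp (ContinuousLinearMap.mul ℂ A a))

/-- The right module action `(x ⊗ y) · a = x ⊗ (y a)`. -/
def rightMul (a : A) : ProjTensor A →L[ℂ] ProjTensor A :=
  lift ((tmulL.flip.comp ((ContinuousLinearMap.mul ℂ A).flip a)).flip)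

/-- The multiplication map `π (x ⊗ y) = x y`. -/
def mulMap [CompleteSpace A] : ProjTensor A →L[ℂ] A :=
  lift (ContinuousLinearMap.mul ℂ A)

theorem leftMul_tmul (a x y : A) : leftMul a (tmul x y) = tmul (a * x) y := by
  simp [leftMul, lift_tmul, tmulL_apply]

theorem rightMul_tmul (a x y : A) : rightMul a (tmul x y) = tmul x (y * a) := by
  simp [rightMul, lift_tmul, tmulL_apply]

theorem mulMap_tmul [CompleteSpace A] (x y : A) : mulMap (tmul x y) = x * y := by
  simp [mulMap, lift_tmul]

end Algebra

end ProjTensor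

/-! ### Bimodules, derivations and approximate contractibility -/

/-- The structure of a Banach `A`-bimodule on a Banach space `X`: jointly bounded bilinear left and
right actions, each associative, that commute with each other. If `A` has a unit, it is not required
to act as the identity. -/
structure BanachBimodule (A X : Type*) [NonUnitalNormedRing A] [NormedSpace ℂ A]
    [NormedAddCommGroup X] [NormedSpace ℂ X] where
  /-- `left a x` is `a · x`. -/
  left : A →L[ℂ] X →L[ℂ] X
  /-- `right a x` is `x · a`. -/
  right : A →L[ℂ] X →L[ℂ] X
  left_mul : ∀ a b x, left (a * b) x = left a (left b x)
  right_mul : ∀ a b x, right (a * b) x = right b (right a x)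
  left_right : ∀ a b x, left a (right b x) = right b (left a x)

namespace BanachBimodule

variable {A X : Type*} [NonUnitalNormedRing A] [NormedSpace ℂ A]
  [NormedAddCommGroup X] [NormedSpace ℂ X]

/-- The continuous linear map `D` is a derivation: `D (a b) = a · D b + D a · b`. -/
def IsDerivation (M : BanachBimodule A X) (D : A →L[ℂ] X) : Prop :=
  ∀ a b, D (a * b) = M.left a (D b) + M.right b (D a)

/-- The inner derivation `ad_x : a ↦ a · x - x · a`. -/
def ad (M : BanachBimodule A X) (x : X) : A →L[ℂ] X :=
  M.left.flip x - M.right.flip x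

theorem ad_apply (M : BanachBimodule A X) (x : X) (a : A) :
    M.ad x a = M.left a x - M.right a x := rfl

end BanachBimodule

section Notions

variable (A : Type u) [NonUnitalNormedRing A] [NormedSpace ℂ A]

/-- Every continuous derivation into a Banach bimodule is the pointwise norm limit of a net of
inner derivations `ad_{x_i}` which is bounded in operator norm. -/
def IsBoundedlyApproxContractible : Prop :=
  ∀ (X : Type u) [NormedAddCommGroup X] [NormedSpace ℂ X] [CompleteSpace X]
    (M : BanachBimodule A X) (D : A →L[ℂ] X), M.IsDerivation D →
    ∃ (ι : Type u) (_ : Preorder ι) (_ : IsDirectedOrder ι) (_ : Nonempty ι) (x : ι → X),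
      (∀ a, Tendsto (fun i => M.ad (x i) a) atTop (𝓝 (D a))) ∧
      ∃ K : ℝ, ∀ i, ‖M.ad (x i)‖ ≤ K

/-- Every continuous derivation into a Banach bimodule is the pointwise norm limit of a sequence of
inner derivations. -/
def IsSequentiallyApproxContractible : Prop :=
  ∀ (X : Type u) [NormedAddCommGroup X] [NormedSpace ℂ X] [CompleteSpace X]
    (M : BanachBimodule A X) (D : A →L[ℂ] X), M.IsDerivation D →
    ∃ x : ℕ → X, ∀ a, Tendsto (fun n => M.ad (x n) a) atTop (𝓝 (D a))

/-- `A` has a bounded (two-sided) approximate identity. -/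
def HasBoundedApproxIdentity : Prop :=
  ∃ (ι : Type u) (_ : Preorder ι) (_ : IsDirectedOrder ι) (_ : Nonempty ι) (e : ι → A),
    (∃ K : ℝ, ∀ i, ‖e i‖ ≤ K) ∧
    ∀ a, Tendsto (fun i => e i * a) atTop (𝓝 a) ∧ Tendsto (fun i => a * e i) atTop (𝓝 a)

variable [IsScalarTower ℂ A A] [SMulCommClass ℂ A A] [CompleteSpace A]

variable {A} in
/-- The net `u` in the projective tensor product is an approximate diagonal:
`a · u_i - u_i · a → 0` and `π(u_i) a → a` for all `a`. -/
def IsApproxDiagonal {ι : Type*} [Preorder ι] (u : ι → ProjTensor A) : Prop :=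
  ∀ a : A,
    Tendsto (fun i => ProjTensor.leftMul a (u i) - ProjTensor.rightMul a (u i)) atTop (𝓝 0) ∧
    Tendsto (fun i => ProjTensor.mulMap (u i) * a) atTop (𝓝 a)

/-- `A` has an approximate diagonal `(u_i)` such that `‖a · u_i - u_i · a‖ ≤ K ‖a‖` and
`‖π(u_i) a‖ ≤ K ‖a‖` for some constant `K`. -/
def IsBoundedlyPseudoAmenable : Prop :=
  ∃ (ι : Type u) (_ : Preorder ι) (_ : IsDirectedOrder ι) (_ : Nonempty ι) (u : ι → ProjTensor A),
    IsApproxDiagonal u ∧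
    ∃ K : ℝ, 0 < K ∧ ∀ i (a : A),
      ‖ProjTensor.leftMul a (u i) - ProjTensor.rightMul a (u i)‖ ≤ K * ‖a‖ ∧
      ‖ProjTensor.mulMap (u i) * a‖ ≤ K * ‖a‖

/-- `A` has an approximate diagonal which is a sequence. -/
def IsSequentiallyPseudoAmenable : Prop :=
  ∃ u : ℕ → ProjTensor A, IsApproxDiagonal u

end Notions

end

/-!
Boundedness and convergence are handled along a fixed directed set `κ`: the natural numbers for
sequences, where the Banach-Steinhaus theorem supplies the bounds, and the pairs of a finite subset
of `A` and a natural number for nets, since every net can be reindexed by these (`exists_reindex`).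
Write `A ⊗ A` for the projective tensor square.

*A bounded approximate identity exists.* Approximating `a ↦ a ⊗ 1 - 1 ⊗ a` by inner derivations of
the bimodule of sums `U + F ⊗ 1 + 1 ⊗ G` gives a left approximate identity `G_k` and a right
approximate identity `F_k`, bounded as multipliers, with `a U_k - U_k a + a ⊗ G_k - F_k ⊗ a` bounded
by a multiple of `‖a‖`. If `G` is unbounded, normalizing some `G_j` of large norm gives a unit vector
`g` whose left multiplier is as small as desired. Take `φ` with `‖φ‖ = φ(g) = 1`, put `a = g` and
apply `φ` to the first leg: `G_k - (φ ⊗ 1)(U_k) g - φ(F_k) g` is bounded independently of `k`, and as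
a left multiplier it is close to `G_k`. The right-hand side is symmetric
(`ProjTensor.exists_bounded_near_left`, `ProjTensor.exists_boundedApproxIdentity`).

*An approximate diagonal exists.* Let `e_k` be a bounded approximate identity. Commutation with the
family `(e_k ⊗ e_k)` is a derivation into the bounded families in `A ⊗ A` whose image under `π`
tends to zero. If the families `x_k` implement it approximately, then `e_i ⊗ e_i - x_k(i)`, with
`i = i(k)` so large that `π(x_k(i))` is small, is the required diagonal
(`BanachBimodule.exists_correction`, `ProjTensor.exists_approxDiagonal`).

*The converse.* In the presence of a bounded approximate identity the elements `f_k = π(u_k)` are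
bounded in norm and form a two-sided approximate identity. With `e = f_k` and `f = π(u)`, where `u`
is so far along the diagonal that `e f` is close to `e`, the element
`u + (1 - e) ⊗ (1 - f)` almost commutes with `A` and is mapped almost to `1` by `π`, in norm; its
image under `x ⊗ y ↦ x · D y` implements `D` approximately (`BanachBimodule.ad_actLift_sub`,
`BanachBimodule.isApproxInner_of_isApproxDiagonal`).
-/

noncomputable section

/-! ### The projective tensor square as a bimodule -/

/-- A Banach bimodule from families of bounded operators `l a : x ↦ a · x` and `r a : x ↦ x · a`
that depend linearly and boundedly on `a`. -/
def BanachBimodule.ofBounded {A X : Type*} [NonUnitalNormedRing A] [NormedSpace ℂ A]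
    [NormedAddCommGroup X] [NormedSpace ℂ X] (l r : A → X →L[ℂ] X)
    (l_add : ∀ a b x, l (a + b) x = l a x + l b x) (l_smul : ∀ (c : ℂ) a x, l (c • a) x = c • l a x)
    (r_add : ∀ a b x, r (a + b) x = r a x + r b x) (r_smul : ∀ (c : ℂ) a x, r (c • a) x = c • r a x)
    (C : ℝ) (norm_l : ∀ a x, ‖l a x‖ ≤ C * ‖a‖ * ‖x‖) (norm_r : ∀ a x, ‖r a x‖ ≤ C * ‖a‖ * ‖x‖)
    (l_mul : ∀ a b x, l (a * b) x = l a (l b x)) (r_mul : ∀ a b x, r (a * b) x = r b (r a x))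
    (l_r : ∀ a b x, l a (r b x) = r b (l a x)) : BanachBimodule A X where
  left := LinearMap.mkContinuous₂
    (LinearMap.mk₂ ℂ (fun a x => l a x) l_add l_smul (fun a => map_add (l a))
      (fun c a => map_smul (l a) c)) C norm_l
  right := LinearMap.mkContinuous₂
    (LinearMap.mk₂ ℂ (fun a x => r a x) r_add r_smul (fun a => map_add (r a))
      (fun c a => map_smul (r a) c)) C norm_r
  left_mul := l_mul
  right_mul := r_mul
  left_right := l_r

namespace ProjTensor

section Space

variable {E F : Type*} [NormedAddCommGroup E] [NormedSpace ℂ E]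
  [NormedAddCommGroup F] [NormedSpace ℂ F]

/-- Elementary tensors span a dense subspace, so bounded linear maps on the projective tensor
product are determined by their values there. -/
theorem hom_ext {S T : ProjTensor E →L[ℂ] F} (h : ∀ x y, S (tmul x y) = T (tmul x y)) :
    S = T := by
  have key : (S.comp UniformSpace.Completion.toComplL).toLinearMap
      = (T.comp (UniformSpace.Completion.toComplL :
          (⨂[ℂ] _ : Fin 2, E) →L[ℂ] ProjTensor E)).toLinearMap := by
    apply PiTensorProduct.ext
    ext m
    have hm : m = ![m 0, m 1] := by ext i; fin_cases i <;> rfl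
    have := h (m 0) (m 1)
    rw [tmul, ← hm] at this
    exact this
  ext t
  induction t using UniformSpace.Completion.induction_on with
  | hp => exact isClosed_eq S.continuous T.continuous
  | ih t => exact LinearMap.congr_fun key t

theorem norm_lift_apply_le [CompleteSpace F] (B : E →L[ℂ] E →L[ℂ] F) {C : ℝ} (hC : 0 ≤ C)
    (hB : ∀ x y, ‖B x y‖ ≤ C * (‖x‖ * ‖y‖)) (t : ProjTensor E) : ‖lift B t‖ ≤ C * ‖t‖ := by
  have hm : ‖toMultilinear B‖ ≤ C :=
    ContinuousMultilinearMap.opNorm_le_bound hC fun m => by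
      simpa [toMultilinear, Fin.prod_univ_two] using hB (m 0) (m 1)
  induction t using UniformSpace.Completion.induction_on with
  | hp => exact isClosed_le (lift B).continuous.norm (by fun_prop)
  | ih t =>
    rw [lift_coe, UniformSpace.Completion.norm_coe]
    refine ContinuousLinearMap.le_of_opNorm_le _ ?_ t
    rwa [LinearIsometryEquiv.norm_map]

theorem add_tmul (x x' y : E) : tmul (x + x') y = tmul x y + tmul x' y :=
  DFunLike.congr_fun (map_add tmulL x x') y

theorem smul_tmul (c : ℂ) (x y : E) : tmul (c • x) y = c • tmul x y :=
  DFunLike.congr_fun (map_smul tmulL c x) y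

theorem tmul_add (x y y' : E) : tmul x (y + y') = tmul x y + tmul x y' :=
  map_add (tmulL x) y y'

theorem tmul_smul (c : ℂ) (x y : E) : tmul x (c • y) = c • tmul x y :=
  map_smul (tmulL x) c y

/-- The slice map `x ⊗ y ↦ φ(x) y`. -/
def sliceLeft [CompleteSpace E] (φ : StrongDual ℂ E) : ProjTensor E →L[ℂ] E :=
  lift (φ.smulRight (ContinuousLinearMap.id ℂ E))

/-- The slice map `x ⊗ y ↦ φ(y) x`. -/
def sliceRight [CompleteSpace E] (φ : StrongDual ℂ E) : ProjTensor E →L[ℂ] E :=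
  lift (φ.smulRight (ContinuousLinearMap.id ℂ E)).flip

theorem sliceLeft_tmul [CompleteSpace E] (φ : StrongDual ℂ E) (x y : E) :
    sliceLeft φ (tmul x y) = φ x • y := by
  simp [sliceLeft, lift_tmul]

theorem sliceRight_tmul [CompleteSpace E] (φ : StrongDual ℂ E) (x y : E) :
    sliceRight φ (tmul x y) = φ y • x := by
  simp [sliceRight, lift_tmul]

theorem norm_sliceLeft_apply_le [CompleteSpace E] (φ : StrongDual ℂ E) (hφ : ‖φ‖ ≤ 1)
    (t : ProjTensor E) : ‖sliceLeft φ t‖ ≤ ‖t‖ := by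
  refine (norm_lift_apply_le _ zero_le_one (fun x y => ?_) t).trans_eq (one_mul _)
  simp only [ContinuousLinearMap.smulRight_apply, smul_apply, ContinuousLinearMap.id_apply,
    norm_smul, one_mul]
  gcongr
  simpa using φ.le_of_opNorm_le hφ x

theorem norm_sliceRight_apply_le [CompleteSpace E] (φ : StrongDual ℂ E) (hφ : ‖φ‖ ≤ 1)
    (t : ProjTensor E) : ‖sliceRight φ t‖ ≤ ‖t‖ := by
  refine (norm_lift_apply_le _ zero_le_one (fun x y => ?_) t).trans_eq (one_mul _)
  simp only [ContinuousLinearMap.flip_apply, ContinuousLinearMap.smulRight_apply,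
    smul_apply, ContinuousLinearMap.id_apply, norm_smul, one_mul]
  rw [mul_comm]
  gcongr
  simpa using φ.le_of_opNorm_le hφ y

end Space

section Algebra

variable {A : Type*} [NonUnitalNormedRing A] [NormedSpace ℂ A] [IsScalarTower ℂ A A]
  [SMulCommClass ℂ A A]

/-- Only the norm of `a` as a left multiplier matters, not the norm of `a` itself. -/
theorem norm_leftMul_apply_le {a : A} {δ : ℝ} (hδ : 0 ≤ δ) (ha : ∀ x, ‖a * x‖ ≤ δ * ‖x‖)
    (t : ProjTensor A) : ‖leftMul a t‖ ≤ δ * ‖t‖ := by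
  refine norm_lift_apply_le _ hδ (fun x y => (norm_tmul_le (a * x) y).trans ?_) t
  rw [← mul_assoc]
  gcongr
  exact ha x

/-- Only the norm of `a` as a right multiplier matters, not the norm of `a` itself. -/
theorem norm_rightMul_apply_le {a : A} {δ : ℝ} (hδ : 0 ≤ δ) (ha : ∀ x, ‖x * a‖ ≤ δ * ‖x‖)
    (t : ProjTensor A) : ‖rightMul a t‖ ≤ δ * ‖t‖ := by
  refine norm_lift_apply_le _ hδ (fun x y => (norm_tmul_le x (y * a)).trans ?_) t
  rw [mul_left_comm]
  gcongr
  exact ha y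

theorem leftMul_add (a b : A) (t : ProjTensor A) :
    leftMul (a + b) t = leftMul a t + leftMul b t :=
  DFunLike.congr_fun (F := ProjTensor A →L[ℂ] ProjTensor A)
    (f := leftMul (a + b)) (g := leftMul a + leftMul b) (hom_ext fun x y => by
      simp only [_root_.add_apply, leftMul_tmul, add_mul, add_tmul]) t

theorem leftMul_smul (c : ℂ) (a : A) (t : ProjTensor A) :
    leftMul (c • a) t = c • leftMul a t :=
  DFunLike.congr_fun (F := ProjTensor A →L[ℂ] ProjTensor A)
    (f := leftMul (c • a)) (g := c • leftMul a) (hom_ext fun x y => by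
      simp only [_root_.smul_apply, leftMul_tmul, smul_mul_assoc, smul_tmul]) t

theorem leftMul_mul (a b : A) (t : ProjTensor A) :
    leftMul (a * b) t = leftMul a (leftMul b t) :=
  DFunLike.congr_fun (F := ProjTensor A →L[ℂ] ProjTensor A)
    (f := leftMul (a * b)) (g := (leftMul a).comp (leftMul b)) (hom_ext fun x y => by
      simp [leftMul_tmul, mul_assoc]) t

theorem rightMul_add (a b : A) (t : ProjTensor A) :
    rightMul (a + b) t = rightMul a t + rightMul b t :=
  DFunLike.congr_fun (F := ProjTensor A →L[ℂ] ProjTensor A)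
    (f := rightMul (a + b)) (g := rightMul a + rightMul b) (hom_ext fun x y => by
      simp only [_root_.add_apply, rightMul_tmul, mul_add, tmul_add]) t

theorem rightMul_smul (c : ℂ) (a : A) (t : ProjTensor A) :
    rightMul (c • a) t = c • rightMul a t :=
  DFunLike.congr_fun (F := ProjTensor A →L[ℂ] ProjTensor A)
    (f := rightMul (c • a)) (g := c • rightMul a) (hom_ext fun x y => by
      simp only [_root_.smul_apply, rightMul_tmul, mul_smul_comm, tmul_smul]) t

theorem rightMul_mul (a b : A) (t : ProjTensor A) :
    rightMul (a * b) t = rightMul b (rightMul a t) :=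
  DFunLike.congr_fun (F := ProjTensor A →L[ℂ] ProjTensor A)
    (f := rightMul (a * b)) (g := (rightMul b).comp (rightMul a)) (hom_ext fun x y => by
      simp [rightMul_tmul, mul_assoc]) t

theorem leftMul_rightMul (a b : A) (t : ProjTensor A) :
    leftMul a (rightMul b t) = rightMul b (leftMul a t) :=
  DFunLike.congr_fun (F := ProjTensor A →L[ℂ] ProjTensor A)
    (f := (leftMul a).comp (rightMul b)) (g := (rightMul b).comp (leftMul a))
    (hom_ext fun x y => by simp [leftMul_tmul, rightMul_tmul]) t

/-- The projective tensor product as a Banach bimodule. -/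
def bimodule : BanachBimodule A (ProjTensor A) :=
  BanachBimodule.ofBounded leftMul rightMul leftMul_add leftMul_smul rightMul_add rightMul_smul 1
    (fun a t => by
      rw [one_mul]
      exact norm_leftMul_apply_le (norm_nonneg a) (norm_mul_le a) t)
    (fun a t => by
      rw [one_mul]
      exact norm_rightMul_apply_le (norm_nonneg a)
        (fun x => (norm_mul_le x a).trans_eq (mul_comm _ _)) t)
    leftMul_mul rightMul_mul leftMul_rightMul

variable [CompleteSpace A]

theorem mulMap_leftMul (a : A) (t : ProjTensor A) : mulMap (leftMul a t) = a * mulMap t :=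
  DFunLike.congr_fun (f := mulMap.comp (leftMul a))
    (g := (ContinuousLinearMap.mul ℂ A a).comp mulMap)
    (hom_ext fun x y => by simp [leftMul_tmul, mulMap_tmul, mul_assoc]) t

theorem mulMap_rightMul (a : A) (t : ProjTensor A) : mulMap (rightMul a t) = mulMap t * a :=
  DFunLike.congr_fun (f := mulMap.comp (rightMul a))
    (g := ((ContinuousLinearMap.mul ℂ A).flip a).comp mulMap)
    (hom_ext fun x y => by simp [rightMul_tmul, mulMap_tmul, mul_assoc]) t

theorem sliceLeft_rightMul (φ : StrongDual ℂ A) (a : A) (t : ProjTensor A) :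
    sliceLeft φ (rightMul a t) = sliceLeft φ t * a :=
  DFunLike.congr_fun (f := (sliceLeft φ).comp (rightMul a))
    (g := ((ContinuousLinearMap.mul ℂ A).flip a).comp (sliceLeft φ))
    (hom_ext fun x y => by simp [rightMul_tmul, sliceLeft_tmul]) t

theorem sliceRight_leftMul (φ : StrongDual ℂ A) (a : A) (t : ProjTensor A) :
    sliceRight φ (leftMul a t) = a * sliceRight φ t :=
  DFunLike.congr_fun (f := (sliceRight φ).comp (leftMul a))
    (g := (ContinuousLinearMap.mul ℂ A a).comp (sliceRight φ))
    (hom_ext fun x y => by simp [leftMul_tmul, sliceRight_tmul]) t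

theorem norm_mulMap_apply_le (t : ProjTensor A) : ‖mulMap t‖ ≤ ‖t‖ := by
  refine (norm_lift_apply_le _ zero_le_one (fun x y => ?_) t).trans_eq (one_mul _)
  simpa using norm_mul_le x y

end Algebra

end ProjTensor

/-! ### Derivations that are boundedly approximately inner along a fixed directed set -/

/-- The map `D` is the pointwise norm limit, along `κ`, of inner derivations `ad_{x_k}` that are
bounded in operator norm. Unlike in the definitions of approximate contractibility, the index set
is prescribed, so that nets and sequences can be treated at the same time. -/
def BanachBimodule.IsApproxInner {A X : Type*} [NonUnitalNormedRing A] [NormedSpace ℂ A]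
    [NormedAddCommGroup X] [NormedSpace ℂ X] (M : BanachBimodule A X) (κ : Type*) [Preorder κ]
    (D : A →L[ℂ] X) : Prop :=
  ∃ x : κ → X, (∀ a, Tendsto (fun k => M.ad (x k) a) atTop (𝓝 (D a))) ∧
    ∃ K : ℝ, ∀ k a, ‖M.ad (x k) a‖ ≤ K * ‖a‖

/-! ### Bounded approximate identities -/

/-- Rescaling a vector of large norm to norm one makes any constant `K` attached to it
small. -/
theorem exists_normalize {E : Type*} [NormedAddCommGroup E] [NormedSpace ℂ E] {K N ε : ℝ}
    (hK : 0 ≤ K) (hN : 0 ≤ N) (hε : 0 < ε) {h : E} (hlarge : N * K + N * K / ε < ‖h‖) :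
    ∃ (c : ℂ) (φ : StrongDual ℂ E), ‖c • h‖ = 1 ∧ ‖φ‖ = 1 ∧ φ (c • h) = 1 ∧
      N * (‖c‖ * K) ≤ 1 ∧ N * (‖c‖ * K) ≤ ε := by
  have hpos : 0 < ‖h‖ := lt_of_le_of_lt (by positivity) hlarge
  have h0 : 0 ≤ N * K := by positivity
  have h0' : 0 ≤ N * K / ε := by positivity
  have h1 : N * K ≤ ‖h‖ := by linarith
  have h2 : N * K ≤ ε * ‖h‖ := (div_le_iff₀' hε).mp (by linarith)
  have hc : ‖((‖h‖⁻¹ : ℝ) : ℂ)‖ = ‖h‖⁻¹ := by rw [Complex.norm_real, norm_inv, norm_norm]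
  have hg1 : ‖((‖h‖⁻¹ : ℝ) : ℂ) • h‖ = 1 := by rw [norm_smul, hc, inv_mul_cancel₀ hpos.ne']
  obtain ⟨φ, hφ, hφg⟩ :=
    exists_dual_vector ℂ (((‖h‖⁻¹ : ℝ) : ℂ) • h) (hg1.trans_ne one_ne_zero)
  rw [hg1] at hφg
  have e : N * (‖h‖⁻¹ * K) = N * K / ‖h‖ := by ring
  refine ⟨_, φ, hg1, hφ, by simpa using hφg, ?_, ?_⟩
  · rw [hc, e, div_le_one hpos]; exact h1
  · rw [hc, e, div_le_iff₀ hpos]; exact h2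

/-- Given a bimodule `T` with a bilinear map `τ : A × A → T` compatible with the actions, the
bimodule of formal sums `U + F ⊗ 1 + 1 ⊗ G` with `U` in `T` and `F`, `G` in `A`, where
`a · (1 ⊗ G) = τ a G` and `(F ⊗ 1) · a = τ F a`. If `T` is the projective tensor square of `A`, this
is a complement of the line through `1 ⊗ 1` in the projective tensor square of the unitization
of `A`. -/
def BanachBimodule.unitized {A T : Type*} [NonUnitalNormedRing A] [NormedSpace ℂ A]
    [IsScalarTower ℂ A A] [SMulCommClass ℂ A A] [NormedAddCommGroup T] [NormedSpace ℂ T]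
    (M : BanachBimodule A T) (τ : A →L[ℂ] A →L[ℂ] T)
    (hl : ∀ a x y, M.left a (τ x y) = τ (a * x) y) (hr : ∀ a x y, M.right a (τ x y) = τ x (y * a)) :
    BanachBimodule A (T × A × A) :=
  BanachBimodule.ofBounded
    (fun a => ((M.left a).comp (ContinuousLinearMap.fst ℂ _ _)
        + (τ a).comp ((ContinuousLinearMap.snd ℂ A A).comp (ContinuousLinearMap.snd ℂ _ _))).prod
      (((ContinuousLinearMap.mul ℂ A a).comp
        ((ContinuousLinearMap.fst ℂ A A).comp (ContinuousLinearMap.snd ℂ _ _))).prod 0))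
    (fun a => ((M.right a).comp (ContinuousLinearMap.fst ℂ _ _)
        + (τ.flip a).comp
          ((ContinuousLinearMap.fst ℂ A A).comp (ContinuousLinearMap.snd ℂ _ _))).prod
      ((0 : (T × A × A) →L[ℂ] A).prod (((ContinuousLinearMap.mul ℂ A).flip a).comp
        ((ContinuousLinearMap.snd ℂ A A).comp (ContinuousLinearMap.snd ℂ _ _)))))
    (fun a b x => by simp; abel)
    (fun c a x => by simp)
    (fun a b x => by simp; abel)
    (fun c a x => by simp)
    (‖M.left‖ + ‖M.right‖ + ‖τ‖ + 1)
    (fun a x => by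
      have h1 : ‖x.1‖ ≤ ‖x‖ := norm_fst_le x
      have h2 : ‖x.2.1‖ ≤ ‖x‖ := (norm_fst_le x.2).trans (norm_snd_le x)
      have h3 : ‖x.2.2‖ ≤ ‖x‖ := (norm_snd_le x.2).trans (norm_snd_le x)
      refine norm_prod_le_iff.mpr ⟨?_, norm_prod_le_iff.mpr ⟨?_, ?_⟩⟩
      · calc ‖M.left a x.1 + τ a x.2.2‖ ≤ ‖M.left‖ * ‖a‖ * ‖x.1‖ + ‖τ‖ * ‖a‖ * ‖x.2.2‖ :=
            (norm_add_le _ _).trans (add_le_add (M.left.le_opNorm₂ _ _) (τ.le_opNorm₂ _ _))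
          _ ≤ ‖M.left‖ * ‖a‖ * ‖x‖ + ‖τ‖ * ‖a‖ * ‖x‖ := by gcongr
          _ = (‖M.left‖ + 0 + ‖τ‖ + 0) * ‖a‖ * ‖x‖ := by ring
          _ ≤ (‖M.left‖ + ‖M.right‖ + ‖τ‖ + 1) * ‖a‖ * ‖x‖ := by gcongr <;> positivity
      · calc ‖a * x.2.1‖ ≤ ‖a‖ * ‖x.2.1‖ := norm_mul_le _ _
          _ ≤ ‖a‖ * ‖x‖ := by gcongr
          _ = (0 + 0 + 0 + 1) * ‖a‖ * ‖x‖ := by ring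
          _ ≤ (‖M.left‖ + ‖M.right‖ + ‖τ‖ + 1) * ‖a‖ * ‖x‖ := by gcongr <;> positivity
      · change ‖(0 : A)‖ ≤ _
        rw [norm_zero]
        positivity)
    (fun a x => by
      have h1 : ‖x.1‖ ≤ ‖x‖ := norm_fst_le x
      have h2 : ‖x.2.1‖ ≤ ‖x‖ := (norm_fst_le x.2).trans (norm_snd_le x)
      have h3 : ‖x.2.2‖ ≤ ‖x‖ := (norm_snd_le x.2).trans (norm_snd_le x)
      refine norm_prod_le_iff.mpr ⟨?_, norm_prod_le_iff.mpr ⟨?_, ?_⟩⟩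
      · calc ‖M.right a x.1 + τ x.2.1 a‖ ≤ ‖M.right‖ * ‖a‖ * ‖x.1‖ + ‖τ‖ * ‖x.2.1‖ * ‖a‖ :=
            (norm_add_le _ _).trans (add_le_add (M.right.le_opNorm₂ _ _) (τ.le_opNorm₂ _ _))
          _ ≤ ‖M.right‖ * ‖a‖ * ‖x‖ + ‖τ‖ * ‖x‖ * ‖a‖ := by gcongr
          _ = (0 + ‖M.right‖ + ‖τ‖ + 0) * ‖a‖ * ‖x‖ := by ring
          _ ≤ (‖M.left‖ + ‖M.right‖ + ‖τ‖ + 1) * ‖a‖ * ‖x‖ := by gcongr <;> positivity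
      · change ‖(0 : A)‖ ≤ _
        rw [norm_zero]
        positivity
      · calc ‖x.2.2 * a‖ ≤ ‖x.2.2‖ * ‖a‖ := norm_mul_le _ _
          _ ≤ ‖x‖ * ‖a‖ := by gcongr
          _ = (0 + 0 + 0 + 1) * ‖a‖ * ‖x‖ := by ring
          _ ≤ (‖M.left‖ + ‖M.right‖ + ‖τ‖ + 1) * ‖a‖ * ‖x‖ := by gcongr <;> positivity)
    (fun a b x => by simp [M.left_mul, hl, mul_assoc])
    (fun a b x => by simp [M.right_mul, hr, mul_assoc])
    (fun a b x => by simp [M.left_right, hl, hr]; abel)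

/-- The derivation `a ↦ a ⊗ 1 - 1 ⊗ a`. -/
def unitizedDerivation (A T : Type*) [NonUnitalNormedRing A] [NormedSpace ℂ A]
    [NormedAddCommGroup T] [NormedSpace ℂ T] : A →L[ℂ] T × A × A :=
  (0 : A →L[ℂ] T).prod ((ContinuousLinearMap.id ℂ A).prod (-ContinuousLinearMap.id ℂ A))

theorem isDerivation_unitizedDerivation {A T : Type*} [NonUnitalNormedRing A] [NormedSpace ℂ A]
    [IsScalarTower ℂ A A] [SMulCommClass ℂ A A] [NormedAddCommGroup T] [NormedSpace ℂ T]
    (M : BanachBimodule A T) (τ : A →L[ℂ] A →L[ℂ] T)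
    (hl : ∀ a x y, M.left a (τ x y) = τ (a * x) y) (hr : ∀ a x y, M.right a (τ x y) = τ x (y * a)) :
    (M.unitized τ hl hr).IsDerivation (unitizedDerivation A T) := by
  intro a b
  simp [unitizedDerivation, BanachBimodule.unitized, BanachBimodule.ofBounded]

namespace ProjTensor

variable {A : Type*} [NonUnitalNormedRing A] [NormedSpace ℂ A] [IsScalarTower ℂ A A]
  [SMulCommClass ℂ A A]

/-- The bimodule of formal sums `U + F ⊗ 1 + 1 ⊗ G` with `U` in the projective tensor square. -/
def unitizedBimodule : BanachBimodule A (ProjTensor A × A × A) :=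
  bimodule.unitized tmulL leftMul_tmul rightMul_tmul

/-- If `a ↦ a ⊗ 1 - 1 ⊗ a` is boundedly approximately inner along `κ`, then `A` has a left and a
right approximate identity along `κ`, both with bounded multiplier norms, that satisfy the hypothesis
of `exists_bounded_near_left`. -/
theorem exists_of_isApproxInner_unitizedDerivation {κ : Type*} [Preorder κ]
    (h : (unitizedBimodule (A := A)).IsApproxInner κ (unitizedDerivation A (ProjTensor A))) :
    ∃ (U : κ → ProjTensor A) (F G : κ → A),
      (∀ a, Tendsto (fun k => a * F k) atTop (𝓝 a)) ∧
      (∀ a, Tendsto (fun k => G k * a) atTop (𝓝 a)) ∧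
      ∃ K : ℝ, 0 ≤ K ∧ ∀ k a, ‖a * F k‖ ≤ K * ‖a‖ ∧ ‖G k * a‖ ≤ K * ‖a‖ ∧
        ‖leftMul a (U k) - rightMul a (U k) + tmul a (G k) - tmul (F k) a‖ ≤ K * ‖a‖ := by
  obtain ⟨x, hx, K, hK⟩ := h
  have had : ∀ k a, unitizedBimodule.ad (x k) a
      = (leftMul a (x k).1 + tmul a (x k).2.2 - (rightMul a (x k).1 + tmul (x k).2.1 a),
        a * (x k).2.1 - 0, 0 - (x k).2.2 * a) := fun _ _ => rfl
  refine ⟨fun k => (x k).1, fun k => (x k).2.1, fun k => (x k).2.2, fun a => ?_, fun a => ?_,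
    max K 0, le_max_right _ _, fun k a => ?_⟩
  · have := (hx a).snd_nhds.fst_nhds
    simpa [had, unitizedDerivation] using this
  · have := (hx a).snd_nhds.snd_nhds.neg
    simpa [had, unitizedDerivation] using this
  · have h1 : ‖unitizedBimodule.ad (x k) a‖ ≤ max K 0 * ‖a‖ :=
      (hK k a).trans (by gcongr; exact le_max_left _ _)
    rw [had] at h1
    have h2 := (norm_prod_le_iff.mp h1).1
    have h3 := norm_prod_le_iff.mp (norm_prod_le_iff.mp h1).2
    refine ⟨by simpa using h3.1, by simpa using h3.2, ?_⟩
    exact (congrArg norm (by dsimp only; abel)).trans_le h2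

variable [CompleteSpace A]

/-- Let `(U, F, G)` stand for an element `U + F ⊗ 1 + 1 ⊗ G` whose commutator with `a`, up to
`a ⊗ 1 - 1 ⊗ a`, has an `A ⊗ A`-component bounded by `K ‖a‖`. If there are `h` of arbitrarily large
norm whose left multipliers are bounded by `K`, then `G` agrees, as a left multiplier and up to
`ε`, with an element of norm at most `K + 1`. -/
theorem exists_bounded_near_left {U : ProjTensor A} {F G : A} {K ε : ℝ} (hK : 0 ≤ K)
    (hU : ∀ a, ‖leftMul a U - rightMul a U + tmul a G - tmul F a‖ ≤ K * ‖a‖)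
    (hh : ∀ C, ∃ h : A, C < ‖h‖ ∧ ∀ x, ‖h * x‖ ≤ K * ‖x‖) (hε : 0 < ε) :
    ∃ e : A, ‖e‖ ≤ K + 1 ∧ ∀ x, ‖(e - G) * x‖ ≤ ε * ‖x‖ := by
  set N := ‖U‖ + ‖F‖ with hN
  have hN0 : 0 ≤ N := by positivity
  obtain ⟨h, hlarge, hmul⟩ := hh (N * K + N * K / ε)
  -- the normalized vector `g = c • h` is nearly annihilated by right factors
  obtain ⟨c, φ, hg1, hφ, hφg, hδ1, hδε⟩ := exists_normalize hK hN0 hε hlarge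
  set δ := ‖c‖ * K
  have hδ0 : 0 ≤ δ := mul_nonneg (norm_nonneg c) hK
  set g := c • h with hg
  have hgx : ∀ x, ‖g * x‖ ≤ δ * ‖x‖ := fun x => by
    rw [hg, smul_mul_assoc, norm_smul, mul_assoc]
    gcongr
    exact hmul x
  refine ⟨G - sliceLeft φ U * g - φ F • g, ?_, fun x => ?_⟩
  · have key : G - sliceLeft φ U * g - φ F • g
        = sliceLeft φ (leftMul g U - rightMul g U + tmul g G - tmul F g)
          - sliceLeft φ (leftMul g U) := by
      simp only [map_sub, map_add, sliceLeft_rightMul, sliceLeft_tmul, hφg, one_smul]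
      abel
    rw [key]
    refine (norm_sub_le _ _).trans (add_le_add ?_ ?_)
    · refine (norm_sliceLeft_apply_le φ hφ.le _).trans ((hU g).trans_eq ?_)
      rw [hg1, mul_one]
    · refine (norm_sliceLeft_apply_le φ hφ.le _).trans
        ((norm_leftMul_apply_le hδ0 hgx U).trans ?_)
      refine le_trans ?_ hδ1
      rw [mul_comm]
      gcongr
      rw [hN]
      linarith [norm_nonneg F]
  · have key : (G - sliceLeft φ U * g - φ F • g - G) * x
        = -(sliceLeft φ U * (g * x)) - φ F • (g * x) := by
      simp only [sub_mul, smul_mul_assoc, mul_assoc]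
      abel
    rw [key]
    refine (norm_sub_le _ _).trans ?_
    rw [norm_neg, norm_smul]
    calc _ ≤ ‖U‖ * (δ * ‖x‖) + ‖F‖ * (δ * ‖x‖) := by
          refine add_le_add ((norm_mul_le _ _).trans ?_) ?_
          · exact mul_le_mul (norm_sliceLeft_apply_le φ hφ.le U) (hgx x) (norm_nonneg _)
              (norm_nonneg _)
          · refine mul_le_mul ?_ (hgx x) (norm_nonneg _) (norm_nonneg _)
            simpa using φ.le_of_opNorm_le hφ.le F
      _ = N * δ * ‖x‖ := by rw [hN]; ring
      _ ≤ ε * ‖x‖ := by gcongr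

/-- The mirror image of `exists_bounded_near_left`. -/
theorem exists_bounded_near_right {U : ProjTensor A} {F G : A} {K ε : ℝ} (hK : 0 ≤ K)
    (hU : ∀ a, ‖leftMul a U - rightMul a U + tmul a G - tmul F a‖ ≤ K * ‖a‖)
    (hh : ∀ C, ∃ h : A, C < ‖h‖ ∧ ∀ x, ‖x * h‖ ≤ K * ‖x‖) (hε : 0 < ε) :
    ∃ e : A, ‖e‖ ≤ K + 1 ∧ ∀ x, ‖x * (e - F)‖ ≤ ε * ‖x‖ := by
  set N := ‖U‖ + ‖G‖ with hN
  have hN0 : 0 ≤ N := by positivity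
  obtain ⟨h, hlarge, hmul⟩ := hh (N * K + N * K / ε)
  obtain ⟨c, φ, hg1, hφ, hφg, hδ1, hδε⟩ := exists_normalize hK hN0 hε hlarge
  set δ := ‖c‖ * K
  have hδ0 : 0 ≤ δ := mul_nonneg (norm_nonneg c) hK
  set g := c • h with hg
  have hgx : ∀ x, ‖x * g‖ ≤ δ * ‖x‖ := fun x => by
    rw [hg, mul_smul_comm, norm_smul, mul_assoc]
    gcongr
    exact hmul x
  refine ⟨F - g * sliceRight φ U - φ G • g, ?_, fun x => ?_⟩
  · have key : F - g * sliceRight φ U - φ G • g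
        = -sliceRight φ (leftMul g U - rightMul g U + tmul g G - tmul F g)
          - sliceRight φ (rightMul g U) := by
      simp only [map_sub, map_add, sliceRight_leftMul, sliceRight_tmul, hφg, one_smul]
      abel
    rw [key]
    refine (norm_sub_le _ _).trans (add_le_add ?_ ?_)
    · rw [norm_neg]
      refine (norm_sliceRight_apply_le φ hφ.le _).trans ((hU g).trans_eq ?_)
      rw [hg1, mul_one]
    · refine (norm_sliceRight_apply_le φ hφ.le _).trans
        ((norm_rightMul_apply_le hδ0 hgx U).trans ?_)
      refine le_trans ?_ hδ1
      rw [mul_comm]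
      gcongr
      rw [hN]
      linarith [norm_nonneg G]
  · have key : x * (F - g * sliceRight φ U - φ G • g - F)
        = -(x * g * sliceRight φ U) - φ G • (x * g) := by
      simp only [mul_sub, mul_smul_comm, mul_assoc]
      abel
    rw [key]
    refine (norm_sub_le _ _).trans ?_
    rw [norm_neg, norm_smul]
    calc _ ≤ (δ * ‖x‖) * ‖U‖ + ‖G‖ * (δ * ‖x‖) := by
          refine add_le_add ((norm_mul_le _ _).trans ?_) ?_
          · exact mul_le_mul (hgx x) (norm_sliceRight_apply_le φ hφ.le U) (norm_nonneg _)
              (by positivity)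
          · refine mul_le_mul ?_ (hgx x) (norm_nonneg _) (norm_nonneg _)
            simpa using φ.le_of_opNorm_le hφ.le G
      _ = N * δ * ‖x‖ := by rw [hN]; ring
      _ ≤ ε * ‖x‖ := by gcongr

/-- If `a ↦ a ⊗ 1 - 1 ⊗ a` is boundedly approximately inner along `κ`, then `A` has a two-sided
bounded approximate identity along `κ`. The map `ε` measures how far along `κ` an index is. -/
theorem exists_boundedApproxIdentity {κ : Type*} [Preorder κ] {ε : κ → ℝ} (hε : ∀ k, 0 < ε k)
    (hε0 : Tendsto ε atTop (𝓝 0))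
    (h : (unitizedBimodule (A := A)).IsApproxInner κ (unitizedDerivation A (ProjTensor A))) :
    ∃ e : κ → A, (∃ C : ℝ, ∀ k, ‖e k‖ ≤ C) ∧
      ∀ a, Tendsto (fun k => e k * a) atTop (𝓝 a) ∧ Tendsto (fun k => a * e k) atTop (𝓝 a) := by
  obtain ⟨U, F, G, hF, hG, K, hK0, hK⟩ := exists_of_isApproxInner_unitizedDerivation h
  have hεa : ∀ a : A, Tendsto (fun k => ε k * ‖a‖) atTop (𝓝 0) := fun a => by
    simpa using hε0.mul_const ‖a‖
  obtain ⟨p, Cp, hpC, hp⟩ : ∃ (p : κ → A) (C : ℝ), (∀ k, ‖p k‖ ≤ C) ∧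
      ∀ a, Tendsto (fun k => p k * a) atTop (𝓝 a) := by
    by_cases hb : ∃ C, ∀ k, ‖G k‖ ≤ C
    · obtain ⟨C, hC⟩ := hb
      exact ⟨G, C, hC, hG⟩
    · push Not at hb
      choose p hp1 hp2 using fun k => exists_bounded_near_left hK0 (fun a => (hK k a).2.2)
        (fun C => (hb C).imp' G fun j hj => ⟨hj, fun x => (hK j x).2.1⟩) (hε k)
      refine ⟨p, K + 1, hp1, fun a => ?_⟩
      have := (squeeze_zero_norm (fun k => hp2 k a) (hεa a)).add (hG a)
      simpa [sub_mul] using this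
  obtain ⟨q, Cq, hqC, hq⟩ : ∃ (q : κ → A) (C : ℝ), (∀ k, ‖q k‖ ≤ C) ∧
      ∀ a, Tendsto (fun k => a * q k) atTop (𝓝 a) := by
    by_cases hb : ∃ C, ∀ k, ‖F k‖ ≤ C
    · obtain ⟨C, hC⟩ := hb
      exact ⟨F, C, hC, hF⟩
    · push Not at hb
      choose q hq1 hq2 using fun k => exists_bounded_near_right hK0 (fun a => (hK k a).2.2)
        (fun C => (hb C).imp' F fun j hj => ⟨hj, fun x => (hK j x).1⟩) (hε k)
      refine ⟨q, K + 1, hq1, fun a => ?_⟩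
      have := (squeeze_zero_norm (fun k => hq2 k a) (hεa a)).add (hF a)
      simpa [mul_sub] using this
  -- `1 - (p + q - q p) = (1 - q) (1 - p)` in the unitization
  refine ⟨fun k => p k + q k - q k * p k, ⟨Cp + Cq + Cq * Cp, fun k => ?_⟩, fun a => ⟨?_, ?_⟩⟩
  · have hCq : 0 ≤ Cq := (norm_nonneg _).trans (hqC k)
    calc ‖p k + q k - q k * p k‖ ≤ ‖p k‖ + ‖q k‖ + ‖q k‖ * ‖p k‖ :=
          (norm_sub_le _ _).trans (add_le_add (norm_add_le _ _) (norm_mul_le _ _))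
      _ ≤ Cp + Cq + Cq * Cp := by
          gcongr
          exacts [hpC k, hqC k, hqC k, hpC k]
  · have h1 : Tendsto (fun k => a - p k * a) atTop (𝓝 0) := by
      simpa using (hp a).const_sub a
    have h2 : Tendsto (fun k => q k * (a - p k * a)) atTop (𝓝 0) :=
      squeeze_zero_norm (fun k => (norm_mul_le _ _).trans
        (mul_le_mul_of_nonneg_right (hqC k) (norm_nonneg _)))
        (by simpa using h1.norm.const_mul Cq)
    have := (hp a).add h2
    rw [add_zero] at this
    refine this.congr fun k => ?_
    simp only [mul_sub, sub_mul, add_mul, mul_assoc]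
    abel
  · have h1 : Tendsto (fun k => a - a * q k) atTop (𝓝 0) := by
      simpa using (hq a).const_sub a
    have h2 : Tendsto (fun k => (a - a * q k) * p k) atTop (𝓝 0) :=
      squeeze_zero_norm (fun k => (norm_mul_le _ _).trans
        (mul_le_mul_of_nonneg_left (hpC k) (norm_nonneg _)))
        (by simpa using h1.norm.mul_const Cp)
    have := (hq a).add h2
    rw [add_zero] at this
    refine this.congr fun k => ?_
    simp only [mul_sub, sub_mul, mul_add, mul_assoc]
    abel

end ProjTensor

/-! ### Approximate diagonals -/

namespace BanachBimodule

open scoped BoundedContinuousFunction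

variable {A X : Type*} [NonUnitalNormedRing A] [NormedSpace ℂ A]
  [NormedAddCommGroup X] [NormedSpace ℂ X]

theorem isDerivation_ad (M : BanachBimodule A X) (x : X) : M.IsDerivation (M.ad x) := by
  intro a b
  simp only [ad_apply, M.left_mul, M.right_mul, map_sub, M.left_right]
  abel

/-- A subspace invariant under both actions, as a bimodule. -/
def restrict (M : BanachBimodule A X) (S : Submodule ℂ X) (hl : ∀ a, ∀ x ∈ S, M.left a x ∈ S)
    (hr : ∀ a, ∀ x ∈ S, M.right a x ∈ S) : BanachBimodule A S :=
  ofBounded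
    (fun a => ((M.left a).comp S.subtypeL).codRestrict S fun x => hl a x x.2)
    (fun a => ((M.right a).comp S.subtypeL).codRestrict S fun x => hr a x x.2)
    (fun a b x => Subtype.ext (DFunLike.congr_fun (map_add M.left a b) x.1))
    (fun c a x => Subtype.ext (DFunLike.congr_fun (map_smul M.left c a) x.1))
    (fun a b x => Subtype.ext (DFunLike.congr_fun (map_add M.right a b) x.1))
    (fun c a x => Subtype.ext (DFunLike.congr_fun (map_smul M.right c a) x.1))
    (max ‖M.left‖ ‖M.right‖)
    (fun a x => (M.left.le_opNorm₂ a x).trans (by gcongr; exacts [le_max_left _ _, le_rfl]))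
    (fun a x => (M.right.le_opNorm₂ a x).trans (by gcongr; exacts [le_max_right _ _, le_rfl]))
    (fun a b x => Subtype.ext (M.left_mul a b x))
    (fun a b x => Subtype.ext (M.right_mul a b x))
    (fun a b x => Subtype.ext (M.left_right a b x))

/-- Bounded families of elements of a bimodule, with the pointwise actions. -/
def boundedFamilies (M : BanachBimodule A X) (κ : Type*) [TopologicalSpace κ] :
    BanachBimodule A (κ →ᵇ X) :=
  ofBounded
    (fun a => (M.left a).compLeftContinuousBounded κ)
    (fun a => (M.right a).compLeftContinuousBounded κ)
    (fun a b x => by ext; simp)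
    (fun c a x => by ext; simp)
    (fun a b x => by ext; simp)
    (fun c a x => by ext; simp)
    (max ‖M.left‖ ‖M.right‖)
    (fun a x => (BoundedContinuousFunction.norm_le (by positivity)).mpr fun k =>
      (M.left.le_opNorm₂ a (x k)).trans (by
        gcongr; exacts [le_max_left _ _, x.norm_coe_le_norm k]))
    (fun a x => (BoundedContinuousFunction.norm_le (by positivity)).mpr fun k =>
      (M.right.le_opNorm₂ a (x k)).trans (by
        gcongr; exacts [le_max_right _ _, x.norm_coe_le_norm k]))
    (fun a b x => by ext k; exact M.left_mul a b (x k))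
    (fun a b x => by ext k; exact M.right_mul a b (x k))
    (fun a b x => by ext k; exact M.left_right a b (x k))

/-- The bounded families whose image under `ρ` tends to zero. -/
def vanishing (κ : Type*) [TopologicalSpace κ] [Preorder κ] {Y : Type*} [NormedAddCommGroup Y]
    [NormedSpace ℂ Y] (ρ : X →L[ℂ] Y) : Submodule ℂ (κ →ᵇ X) where
  carrier := {v | Tendsto (fun k => ρ (v k)) atTop (𝓝 0)}
  add_mem' {v w} hv hw := by simpa using Tendsto.add hv hw
  zero_mem' := by simpa using tendsto_const_nhds
  smul_mem' c v hv := by simpa using Tendsto.const_smul hv c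

theorem isClosed_vanishing (κ : Type*) [TopologicalSpace κ] [Preorder κ] {Y : Type*}
    [NormedAddCommGroup Y] [NormedSpace ℂ Y] (ρ : X →L[ℂ] Y) :
    IsClosed (vanishing κ ρ : Set (κ →ᵇ X)) := by
  refine isClosed_of_closure_subset fun v hv => ?_
  refine Metric.tendsto_nhds.mpr fun ε hε => ?_
  obtain ⟨w, hw, hvw⟩ := Metric.mem_closure_iff.mp hv (ε / (2 * (‖ρ‖ + 1))) (by positivity)
  filter_upwards [Metric.tendsto_nhds.mp hw (ε / 2) (by positivity)] with k hk
  rw [dist_zero_right] at hk ⊢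
  have h1 : ‖ρ (v k - w k)‖ ≤ ε / 2 := by
    refine (ρ.le_opNorm _).trans ?_
    have h2 : ‖v k - w k‖ ≤ ε / (2 * (‖ρ‖ + 1)) := by
      rw [← dist_eq_norm]
      exact (v.dist_coe_le_dist k).trans hvw.le
    calc ‖ρ‖ * ‖v k - w k‖ ≤ (‖ρ‖ + 1) * (ε / (2 * (‖ρ‖ + 1))) := by gcongr; linarith
      _ = ε / 2 := by field_simp
  calc ‖ρ (v k)‖ = ‖ρ (v k - w k) + ρ (w k)‖ := by rw [map_sub, sub_add_cancel]
    _ ≤ ‖ρ (v k - w k)‖ + ‖ρ (w k)‖ := norm_add_le _ _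
    _ < ε := by linarith

/-- The bounded families in `M` whose image under the bimodule map `ρ` to `A` tends to zero. -/
def vanishingFamilies [IsScalarTower ℂ A A] [SMulCommClass ℂ A A] (M : BanachBimodule A X)
    (κ : Type*) [TopologicalSpace κ] [Preorder κ]
    (ρ : X →L[ℂ] A) (hl : ∀ a x, ρ (M.left a x) = a * ρ x) (hr : ∀ a x, ρ (M.right a x) = ρ x * a) :
    BanachBimodule A (vanishing κ ρ) :=
  (M.boundedFamilies κ).restrict _
    (fun a v hv => by
      change Tendsto (fun k => ρ (M.left a (v k))) atTop (𝓝 0)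
      simpa [hl] using Tendsto.const_mul a hv)
    (fun a v hv => by
      change Tendsto (fun k => ρ (M.right a (v k))) atTop (𝓝 0)
      simpa [hr] using Tendsto.mul_const a hv)

/-- For a bounded family `m` that is asymptotically central under `ρ`, commutation with `m` is a
derivation into the families that vanish asymptotically under `ρ`, although `m` itself need not be
one of them. -/
theorem exists_derivation_vanishingFamilies [IsScalarTower ℂ A A] [SMulCommClass ℂ A A]
    (M : BanachBimodule A X) {κ : Type*} [TopologicalSpace κ] [DiscreteTopology κ] [Preorder κ]
    (ρ : X →L[ℂ] A) (hl : ∀ a x, ρ (M.left a x) = a * ρ x) (hr : ∀ a x, ρ (M.right a x) = ρ x * a)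
    (m : κ → X) {C : ℝ} (hC : ∀ k, ‖m k‖ ≤ C)
    (hm : ∀ a, Tendsto (fun k => a * ρ (m k) - ρ (m k) * a) atTop (𝓝 0)) :
    ∃ D : A →L[ℂ] vanishing κ ρ, (M.vanishingFamilies κ ρ hl hr).IsDerivation D ∧
      ∀ a k, (D a : κ →ᵇ X) k = M.left a (m k) - M.right a (m k) := by
  let m' : κ →ᵇ X := BoundedContinuousFunction.ofNormedAddCommGroupDiscrete m C hC
  refine ⟨((M.boundedFamilies κ).ad m').codRestrict (vanishing κ ρ) fun a => ?_,
    fun a b => Subtype.ext ((M.boundedFamilies κ).isDerivation_ad m' a b), fun a k => rfl⟩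
  change Tendsto (fun k => ρ (M.left a (m k) - M.right a (m k))) atTop (𝓝 0)
  simpa [hl, hr] using hm a

/-- Correcting a bounded family `m` whose image under `ρ` is asymptotically central: subtracting
elements `v k` that are small under `ρ` from a subfamily of `m` makes the family itself
asymptotically central, with bounded commutators. -/
theorem exists_correction [IsScalarTower ℂ A A] [SMulCommClass ℂ A A]
    (M : BanachBimodule A X) {κ : Type*} [TopologicalSpace κ] [DiscreteTopology κ] [Preorder κ]
    [IsDirectedOrder κ] [Nonempty κ] {ε : κ → ℝ} (hε : ∀ k, 0 < ε k)
    (ρ : X →L[ℂ] A) (hl : ∀ a x, ρ (M.left a x) = a * ρ x) (hr : ∀ a x, ρ (M.right a x) = ρ x * a)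
    (h : ∀ D, (M.vanishingFamilies κ ρ hl hr).IsDerivation D →
      (M.vanishingFamilies κ ρ hl hr).IsApproxInner κ D)
    (m : κ → X) {C : ℝ} (hC : ∀ k, ‖m k‖ ≤ C)
    (hm : ∀ a, Tendsto (fun k => a * ρ (m k) - ρ (m k) * a) atTop (𝓝 0)) :
    ∃ (i : κ → κ) (v : κ → X), Tendsto i atTop atTop ∧ (∀ k, ‖ρ (v k)‖ ≤ ε k) ∧
      (∀ a, Tendsto (fun k => M.left a (m (i k) - v k) - M.right a (m (i k) - v k)) atTop (𝓝 0)) ∧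
      ∃ K : ℝ, 0 ≤ K ∧
        ∀ k a, ‖M.left a (m (i k) - v k) - M.right a (m (i k) - v k)‖ ≤ K * ‖a‖ := by
  obtain ⟨D, hD, hDm⟩ := M.exists_derivation_vanishingFamilies ρ hl hr m hC hm
  obtain ⟨x, hx, K, hK⟩ := h D hD
  -- `x k` vanishes asymptotically under `ρ`, so that it is small at some index `i ≥ k`
  have hxk : ∀ k, ∃ i, k ≤ i ∧ ‖ρ ((x k).1 i)‖ ≤ ε k := fun k => by
    have h1 : Tendsto (fun i => ρ ((x k).1 i)) atTop (𝓝 0) := (x k).2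
    have h2 : ∀ᶠ i in atTop, ‖ρ ((x k).1 i)‖ < ε k :=
      h1.norm.eventually_lt_const (by simpa using hε k)
    exact ((eventually_ge_atTop k).and h2).exists.imp fun i hi => ⟨hi.1, hi.2.le⟩
  choose i hi hxi using hxk
  have hcomm : ∀ k a, ‖M.left a (m (i k) - (x k).1 (i k)) - M.right a (m (i k) - (x k).1 (i k))‖
      ≤ ‖D a - (M.vanishingFamilies κ ρ hl hr).ad (x k) a‖ := fun k a => by
    refine le_trans (le_of_eq ?_)
      ((D a - (M.vanishingFamilies κ ρ hl hr).ad (x k) a).1.norm_coe_le_norm (i k))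
    have : (D a - (M.vanishingFamilies κ ρ hl hr).ad (x k) a).1 (i k)
        = (M.left a (m (i k)) - M.right a (m (i k)))
          - (M.left a ((x k).1 (i k)) - M.right a ((x k).1 (i k))) :=
      congrArg₂ (· - ·) (hDm a (i k)) rfl
    rw [this, map_sub, map_sub]
    congr 1
    abel
  refine ⟨i, fun k => (x k).1 (i k), tendsto_atTop_mono hi tendsto_id, hxi, fun a => ?_,
    ‖D‖ + |K|, by positivity, fun k a => ?_⟩
  · refine squeeze_zero_norm (fun k => hcomm k a) ?_
    simpa using ((hx a).const_sub (D a)).norm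
  · refine (hcomm k a).trans ((norm_sub_le _ _).trans ?_)
    have h3 : K * ‖a‖ ≤ |K| * ‖a‖ := by gcongr; exact le_abs_self K
    linarith [D.le_opNorm a, hK k a]

end BanachBimodule

namespace ProjTensor

variable {A : Type*} [NonUnitalNormedRing A] [NormedSpace ℂ A] [IsScalarTower ℂ A A]
  [SMulCommClass ℂ A A] [CompleteSpace A]

/-- If `A` has a bounded approximate identity along `κ` and every derivation into the bimodule of
families in `A ⊗ A` that vanish asymptotically under the multiplication map is boundedly
approximately inner along `κ`, then `A` has an approximate diagonal along `κ` with bounded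
commutators and bounded multiplication. -/
theorem exists_approxDiagonal {κ : Type*} [TopologicalSpace κ] [DiscreteTopology κ] [Preorder κ]
    [IsDirectedOrder κ] [Nonempty κ] {ε : κ → ℝ} (hε : ∀ k, 0 < ε k)
    (hε0 : Tendsto ε atTop (𝓝 0)) {e : κ → A} {C : ℝ} (hC : ∀ k, ‖e k‖ ≤ C)
    (he : ∀ a, Tendsto (fun k => e k * a) atTop (𝓝 a) ∧ Tendsto (fun k => a * e k) atTop (𝓝 a))
    (h : ∀ D, (bimodule.vanishingFamilies κ (mulMap (A := A)) mulMap_leftMul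
        mulMap_rightMul).IsDerivation D →
      (bimodule.vanishingFamilies κ (mulMap (A := A)) mulMap_leftMul
        mulMap_rightMul).IsApproxInner κ D) :
    ∃ u : κ → ProjTensor A, IsApproxDiagonal u ∧ ∃ K : ℝ, 0 < K ∧ ∀ i (a : A),
      ‖leftMul a (u i) - rightMul a (u i)‖ ≤ K * ‖a‖ ∧ ‖mulMap (u i) * a‖ ≤ K * ‖a‖ := by
  have hC0 : 0 ≤ C := (norm_nonneg _).trans (hC (Classical.arbitrary κ))
  have hmC : ∀ k, ‖tmul (e k) (e k)‖ ≤ C * C := fun k =>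
    (norm_tmul_le _ _).trans (mul_le_mul (hC k) (hC k) (norm_nonneg _) hC0)
  have hee : ∀ a, Tendsto (fun k => e k * e k * a) atTop (𝓝 a) := fun a => by
    have h1 : Tendsto (fun k => e k * a - a) atTop (𝓝 0) := by
      simpa using (he a).1.sub_const a
    have h2 : Tendsto (fun k => e k * (e k * a - a)) atTop (𝓝 0) :=
      squeeze_zero_norm (fun k => (norm_mul_le _ _).trans
        (mul_le_mul_of_nonneg_right (hC k) (norm_nonneg _))) (by simpa using h1.norm.const_mul C)
    simpa [mul_sub, mul_assoc] using h2.add (he a).1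
  have hee' : ∀ a, Tendsto (fun k => a * (e k * e k)) atTop (𝓝 a) := fun a => by
    have h1 : Tendsto (fun k => a * e k - a) atTop (𝓝 0) := by
      simpa using (he a).2.sub_const a
    have h2 : Tendsto (fun k => (a * e k - a) * e k) atTop (𝓝 0) :=
      squeeze_zero_norm (fun k => (norm_mul_le _ _).trans
        (mul_le_mul_of_nonneg_left (hC k) (norm_nonneg _))) (by simpa using h1.norm.mul_const C)
    simpa [sub_mul, mul_assoc] using h2.add (he a).2
  obtain ⟨i, v, hi, hv, hcomm, K, hK0, hK⟩ := bimodule.exists_correction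
    (fun k => lt_min (hε k) one_pos) (mulMap (A := A)) mulMap_leftMul mulMap_rightMul h
    (fun k => tmul (e k) (e k)) hmC fun a => by
      simpa [mulMap_tmul] using (hee' a).sub (hee a)
  refine ⟨fun k => tmul (e (i k)) (e (i k)) - v k, fun a => ⟨hcomm a, ?_⟩,
    K + C * C + 1, by positivity, fun k a => ⟨(hK k a).trans ?_, ?_⟩⟩
  · have h1 : Tendsto (fun k => mulMap (v k) * a) atTop (𝓝 0) := by
      refine squeeze_zero_norm (a := fun k => ε k * ‖a‖) (fun k => ?_)
        (by simpa using hε0.mul_const ‖a‖)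
      exact (norm_mul_le _ _).trans
        (mul_le_mul_of_nonneg_right ((hv k).trans (min_le_left _ _)) (norm_nonneg a))
    have h2 := ((hee a).comp hi).sub h1
    rw [sub_zero] at h2
    refine h2.congr fun k => ?_
    rw [map_sub, mulMap_tmul, sub_mul]
    rfl
  · gcongr
    linarith [mul_nonneg hC0 hC0]
  · have h1 : ‖mulMap (tmul (e (i k)) (e (i k)) - v k)‖ ≤ C * C + 1 := by
      rw [map_sub]
      exact (norm_sub_le _ _).trans (add_le_add
        ((norm_mulMap_apply_le _).trans (hmC (i k))) ((hv k).trans (min_le_right _ _)))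
    refine (norm_mul_le _ _).trans ?_
    gcongr
    linarith

end ProjTensor

/-! ### From approximate diagonals to approximately inner derivations -/

namespace BanachBimodule

open ProjTensor

variable {A X : Type*} [NonUnitalNormedRing A] [NormedSpace ℂ A] [IsScalarTower ℂ A A]
  [SMulCommClass ℂ A A] [NormedAddCommGroup X] [NormedSpace ℂ X] [CompleteSpace X]

/-- The bounded linear map `x ⊗ y ↦ x · D y`. -/
def actLift (M : BanachBimodule A X) (D : A →L[ℂ] X) : ProjTensor A →L[ℂ] X :=
  lift (M.left.flip.comp D).flip

theorem actLift_tmul (M : BanachBimodule A X) (D : A →L[ℂ] X) (x y : A) :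
    M.actLift D (tmul x y) = M.left x (D y) := by
  simp [actLift, lift_tmul]

theorem norm_actLift_apply_le (M : BanachBimodule A X) (D : A →L[ℂ] X) (t : ProjTensor A) :
    ‖M.actLift D t‖ ≤ ‖M.left‖ * ‖D‖ * ‖t‖ := by
  refine norm_lift_apply_le _ (by positivity) (fun x y => ?_) t
  calc ‖M.left x (D y)‖ ≤ ‖M.left‖ * ‖x‖ * (‖D‖ * ‖y‖) :=
        (M.left.le_opNorm₂ _ _).trans (by gcongr; exact D.le_opNorm y)
    _ = ‖M.left‖ * ‖D‖ * (‖x‖ * ‖y‖) := by ring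

theorem actLift_leftMul (M : BanachBimodule A X) (D : A →L[ℂ] X) (a : A) (t : ProjTensor A) :
    M.actLift D (leftMul a t) = M.left a (M.actLift D t) :=
  DFunLike.congr_fun (f := (M.actLift D).comp (leftMul a)) (g := (M.left a).comp (M.actLift D))
    (hom_ext fun x y => by simp [leftMul_tmul, actLift_tmul, M.left_mul]) t

theorem actLift_rightMul [CompleteSpace A] {M : BanachBimodule A X} {D : A →L[ℂ] X}
    (hD : M.IsDerivation D) (a : A) (t : ProjTensor A) :
    M.actLift D (rightMul a t) = M.left (mulMap t) (D a) + M.right a (M.actLift D t) :=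
  DFunLike.congr_fun (f := (M.actLift D).comp (rightMul a))
    (g := (M.left.flip (D a)).comp mulMap + (M.right a).comp (M.actLift D))
    (hom_ext fun x y => by
      simp [rightMul_tmul, actLift_tmul, mulMap_tmul, hD y a, M.left_mul, M.left_right]) t

/-- The element `Φ(u) - (1 - e) · D f` with `Φ(x ⊗ y) = x · D y` and `f = π(u)` is the value of `Φ`
at `u + (1 - e) ⊗ (1 - f)` in the tensor square of the unitization. The inner derivation it
implements differs from `D` by terms that are small if `u` almost commutes with `a`, if `e` and
`f` almost fix `a`, and if `f` almost fixes `e`. -/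
theorem ad_actLift_sub [CompleteSpace A] {M : BanachBimodule A X} {D : A →L[ℂ] X}
    (hD : M.IsDerivation D) (u : ProjTensor A) (e a : A) :
    M.ad (M.actLift D u - D (mulMap u) + M.left e (D (mulMap u))) a - D a
      = M.actLift D (leftMul a u - rightMul a u) - M.left (a - a * e) (D (mulMap u))
        + D (mulMap u * a - a) - M.left e (D (mulMap u * a - a))
        - M.left (e - e * mulMap u) (D a) := by
  rw [map_sub (M.actLift D), actLift_leftMul, actLift_rightMul hD, map_sub D, hD]
  simp only [ad_apply, map_sub, map_add, sub_apply, M.left_mul, M.left_right]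
  abel

theorem norm_ad_actLift_sub_le [CompleteSpace A] {M : BanachBimodule A X} {D : A →L[ℂ] X}
    (hD : M.IsDerivation D) (u : ProjTensor A) (e a : A) {R : ℝ} (he : ‖e‖ ≤ R)
    (hf : ‖mulMap u‖ ≤ R) :
    ‖M.ad (M.actLift D u - D (mulMap u) + M.left e (D (mulMap u))) a - D a‖
      ≤ ‖M.left‖ * ‖D‖ * ‖leftMul a u - rightMul a u‖ + ‖M.left‖ * ‖D‖ * R * ‖a - a * e‖
        + (1 + ‖M.left‖ * R) * ‖D‖ * ‖mulMap u * a - a‖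
        + ‖M.left‖ * ‖D‖ * ‖a‖ * ‖e - e * mulMap u‖ := by
  have hR : 0 ≤ R := (norm_nonneg _).trans he
  have hDle := fun y => D.le_opNorm y
  rw [ad_actLift_sub hD]
  have h1 := M.norm_actLift_apply_le D (leftMul a u - rightMul a u)
  have h2 : ‖M.left (a - a * e) (D (mulMap u))‖ ≤ ‖M.left‖ * ‖a - a * e‖ * (‖D‖ * R) :=
    (M.left.le_opNorm₂ _ _).trans (by gcongr; exact (hDle _).trans (by gcongr))
  have h3 := hDle (mulMap u * a - a)
  have h4 : ‖M.left e (D (mulMap u * a - a))‖ ≤ ‖M.left‖ * R * (‖D‖ * ‖mulMap u * a - a‖) :=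
    (M.left.le_opNorm₂ _ _).trans (by gcongr)
  have h5 : ‖M.left (e - e * mulMap u) (D a)‖ ≤ ‖M.left‖ * ‖e - e * mulMap u‖ * (‖D‖ * ‖a‖) :=
    (M.left.le_opNorm₂ _ _).trans (by gcongr; exact hDle a)
  have h6 := (norm_sub_le_of_le (norm_sub_le_of_le (norm_add_le_of_le (norm_sub_le_of_le h1 h2) h3)
    h4) h5)
  refine h6.trans (le_of_eq ?_)
  ring

/-- A bounded approximate diagonal in the sense of pseudo-amenability, together with a bounded right
approximate identity `e`, makes every derivation boundedly approximately inner. -/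
theorem isApproxInner_of_isApproxDiagonal [CompleteSpace A] {κ ι : Type*} [Preorder κ]
    [IsDirectedOrder κ] [Nonempty κ] {ε : κ → ℝ} (hε : ∀ k, 0 < ε k)
    (hε0 : Tendsto ε atTop (𝓝 0)) {u : κ → ProjTensor A} (hu : IsApproxDiagonal u) {K : ℝ}
    (hK0 : 0 ≤ K) (hK : ∀ k a, ‖leftMul a (u k) - rightMul a (u k)‖ ≤ K * ‖a‖ ∧
      ‖mulMap (u k) * a‖ ≤ K * ‖a‖)
    {l : Filter ι} [l.NeBot] {e : ι → A} {C : ℝ} (hC : ∀ i, ‖e i‖ ≤ C)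
    (he : ∀ a, Tendsto (fun i => a * e i) l (𝓝 a))
    {M : BanachBimodule A X} {D : A →L[ℂ] X} (hD : M.IsDerivation D) : M.IsApproxInner κ D := by
  set f : κ → A := fun k => mulMap (u k) with hf
  have hR : ∀ k, ‖f k‖ ≤ K * C := fun k =>
    le_of_tendsto (he (f k)).norm (.of_forall fun i =>
      ((hK k (e i)).2).trans (by gcongr; exact hC i))
  have hfl : ∀ a, Tendsto (fun k => f k * a) atTop (𝓝 a) := fun a => (hu a).2
  -- applying `π` to the commutators shows that `f` is a right approximate identity as well
  have hfr : ∀ a, Tendsto (fun k => a * f k) atTop (𝓝 a) := fun a => by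
    have h1 := ((mulMap (A := A)).continuous.tendsto 0).comp (hu a).1
    rw [map_zero] at h1
    have h2 := h1.add (hfl a)
    rw [zero_add] at h2
    refine h2.congr fun k => ?_
    simp only [Function.comp_apply, map_sub, mulMap_leftMul, mulMap_rightMul]
    exact sub_add_cancel _ _
  have hj : ∀ k, ∃ j, k ≤ j ∧ ‖f k - f k * f j‖ ≤ min (ε k) 1 := fun k => by
    have h1 : Tendsto (fun j => f k - f k * f j) atTop (𝓝 0) := by
      simpa using (hfr (f k)).const_sub (f k)
    have h2 : ∀ᶠ j in atTop, ‖f k - f k * f j‖ < min (ε k) 1 :=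
      h1.norm.eventually_lt_const (by simpa using hε k)
    exact ((eventually_ge_atTop k).and h2).exists.imp fun j hj => ⟨hj.1, hj.2.le⟩
  -- the diagonal element `u (j k)` is taken so far along that it almost fixes `f k`
  choose j hkj hj using hj
  have hj' : Tendsto j atTop atTop := tendsto_atTop_mono hkj tendsto_id
  have hle := fun k a => norm_ad_actLift_sub_le hD (u (j k)) (f k) a (hR k) (hR (j k))
  have hR0 : 0 ≤ K * C := (norm_nonneg _).trans (hR (Classical.arbitrary κ))
  refine ⟨fun k => M.actLift D (u (j k)) - D (f (j k)) + M.left (f k) (D (f (j k))),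
    fun a => ?_, ?_⟩
  · rw [tendsto_iff_norm_sub_tendsto_zero]
    refine squeeze_zero (fun _ => norm_nonneg _) (fun k => hle k a) ?_
    have h1 := ((hu a).1.comp hj').norm
    have h2 : Tendsto (fun k => ‖a - a * f k‖) atTop (𝓝 0) := by
      simpa using ((hfr a).const_sub a).norm
    have h3 : Tendsto (fun k => ‖f (j k) * a - a‖) atTop (𝓝 0) := by
      simpa using (((hfl a).comp hj').sub_const a).norm
    have h4 : Tendsto (fun k => ‖f k - f k * f (j k)‖) atTop (𝓝 0) :=
      squeeze_zero (fun _ => norm_nonneg _) (fun k => (hj k).trans (min_le_left _ _)) hε0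
    rw [norm_zero] at h1
    simpa using (((h1.const_mul (‖M.left‖ * ‖D‖)).add
      (h2.const_mul (‖M.left‖ * ‖D‖ * (K * C)))).add
      (h3.const_mul ((1 + ‖M.left‖ * (K * C)) * ‖D‖))).add (h4.const_mul (‖M.left‖ * ‖D‖ * ‖a‖))
  · refine ⟨‖M.left‖ * ‖D‖ * K + ‖M.left‖ * ‖D‖ * (K * C) * (1 + K * C)
      + (1 + ‖M.left‖ * (K * C)) * ‖D‖ * (K + 1) + ‖M.left‖ * ‖D‖ + ‖D‖, fun k a => ?_⟩
    have h1 := (hK (j k) a).1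
    have h2 : ‖a - a * f k‖ ≤ (1 + K * C) * ‖a‖ := by
      refine (norm_sub_le _ _).trans ?_
      have := (norm_mul_le a (f k)).trans (mul_le_mul_of_nonneg_left (hR k) (norm_nonneg a))
      linarith
    have h3 : ‖f (j k) * a - a‖ ≤ (K + 1) * ‖a‖ := by
      refine (norm_sub_le _ _).trans ?_
      linarith [(hK (j k) a).2]
    have h4 : ‖f k - f k * f (j k)‖ ≤ 1 := (hj k).trans (min_le_right _ _)
    set x := M.actLift D (u (j k)) - D (f (j k)) + M.left (f k) (D (f (j k)))
    calc ‖M.ad x a‖ = ‖(M.ad x a - D a) + D a‖ := by rw [sub_add_cancel]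
      _ ≤ ‖M.ad x a - D a‖ + ‖D a‖ := norm_add_le _ _
      _ ≤ (‖M.left‖ * ‖D‖ * (K * ‖a‖) + ‖M.left‖ * ‖D‖ * (K * C) * ((1 + K * C) * ‖a‖)
          + (1 + ‖M.left‖ * (K * C)) * ‖D‖ * ((K + 1) * ‖a‖) + ‖M.left‖ * ‖D‖ * ‖a‖ * 1)
          + ‖D‖ * ‖a‖ := by
        refine add_le_add ((hle k a).trans ?_) (D.le_opNorm a)
        gcongr
      _ = _ := by ring

end BanachBimodule

/-! ### Nets and sequences -/

theorem tendsto_one_div_finset_prod_nat (α : Type*) :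
    Tendsto (fun p : Finset α × ℕ => 1 / ((p.2 : ℝ) + 1)) atTop (𝓝 0) := by
  rw [← prod_atTop_atTop_eq]
  exact tendsto_one_div_add_atTop_nhds_zero_nat.comp tendsto_snd

/-- If a family of functions indexed by `α` tends to zero along some filter, then it does so along
a net indexed by the finite subsets of `α` and the natural numbers. The index set depends only
on `α`, and lives in its universe. -/
theorem exists_reindex {α ι : Type*} {l : Filter ι} [l.NeBot] {f : α → ι → ℝ}
    (hf : ∀ a, Tendsto (f a) l (𝓝 0)) :
    ∃ r : Finset α × ℕ → ι, ∀ a, Tendsto (fun p => f a (r p)) atTop (𝓝 0) := by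
  have h : ∀ p : Finset α × ℕ, ∃ i, ∀ a ∈ p.1, |f a i| < 1 / ((p.2 : ℝ) + 1) := fun p =>
    ((Filter.eventually_all_finset p.1).mpr fun a _ =>
      (by simpa using (hf a).abs : Tendsto (fun i => |f a i|) l (𝓝 0)).eventually_lt_const
        Nat.one_div_pos_of_nat).exists
  choose r hr using h
  refine ⟨r, fun a => squeeze_zero_norm' ?_ (tendsto_one_div_finset_prod_nat α)⟩
  filter_upwards [eventually_ge_atTop (({a} : Finset α), 0)] with p hp
  exact (hr p a (hp.1 (Finset.mem_singleton_self a))).le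

/-- A pointwise convergent sequence of bounded operators on a Banach space is uniformly bounded. -/
theorem exists_bound_of_tendsto {E F : Type*} [NormedAddCommGroup E] [NormedSpace ℂ E]
    [CompleteSpace E] [NormedAddCommGroup F] [NormedSpace ℂ F] {g : ℕ → E →L[ℂ] F} {y : E → F}
    (hg : ∀ a, Tendsto (fun n => g n a) atTop (𝓝 (y a))) :
    ∃ K : ℝ, 0 ≤ K ∧ ∀ n a, ‖g n a‖ ≤ K * ‖a‖ := by
  obtain ⟨K, hK⟩ := banach_steinhaus (g := g) fun a => by
    obtain ⟨C, hC⟩ := (hg a).norm.bddAbove_range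
    exact ⟨C, fun n => hC ⟨n, rfl⟩⟩
  exact ⟨K, (norm_nonneg _).trans (hK 0), fun n a => (g n).le_of_opNorm_le (hK n) a⟩

theorem hasBoundedApproxIdentity_of_tendsto {A : Type u} [NonUnitalNormedRing A]
    {κ : Type*} {l : Filter κ} [l.NeBot] {e : κ → A} {C : ℝ} (hC : ∀ k, ‖e k‖ ≤ C)
    (he : ∀ a, Tendsto (fun k => e k * a) l (𝓝 a) ∧ Tendsto (fun k => a * e k) l (𝓝 a)) :
    HasBoundedApproxIdentity A := by
  classical
  obtain ⟨r, hr⟩ := exists_reindex (f := fun a k => ‖e k * a - a‖ + ‖a * e k - a‖) fun a => by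
    simpa using (tendsto_iff_norm_sub_tendsto_zero.mp (he a).1).add
      (tendsto_iff_norm_sub_tendsto_zero.mp (he a).2)
  refine ⟨Finset A × ℕ, inferInstance, inferInstance, inferInstance, e ∘ r,
    ⟨C, fun k => hC (r k)⟩, fun a => ⟨?_, ?_⟩⟩
  · exact tendsto_iff_norm_sub_tendsto_zero.mpr
      (squeeze_zero (fun _ => norm_nonneg _) (fun _ => le_add_of_nonneg_right (norm_nonneg _)) (hr a))
  · exact tendsto_iff_norm_sub_tendsto_zero.mpr
      (squeeze_zero (fun _ => norm_nonneg _) (fun _ => le_add_of_nonneg_left (norm_nonneg _)) (hr a))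

section

variable {A : Type u} [NonUnitalNormedRing A] [NormedSpace ℂ A]

theorem IsBoundedlyApproxContractible.isApproxInner (h : IsBoundedlyApproxContractible A)
    {X : Type u} [NormedAddCommGroup X] [NormedSpace ℂ X] [CompleteSpace X]
    {M : BanachBimodule A X} {D : A →L[ℂ] X} (hD : M.IsDerivation D) :
    M.IsApproxInner (Finset A × ℕ) D := by
  obtain ⟨ι, _, _, _, x, hx, K, hK⟩ := h X M D hD
  obtain ⟨r, hr⟩ := exists_reindex fun a => tendsto_iff_norm_sub_tendsto_zero.mp (hx a)
  exact ⟨x ∘ r, fun a => tendsto_iff_norm_sub_tendsto_zero.mpr (hr a), K,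
    fun k a => (M.ad (x (r k))).le_of_opNorm_le (hK (r k)) a⟩

theorem IsSequentiallyApproxContractible.isApproxInner [CompleteSpace A]
    (h : IsSequentiallyApproxContractible A) {X : Type u} [NormedAddCommGroup X] [NormedSpace ℂ X]
    [CompleteSpace X] {M : BanachBimodule A X} {D : A →L[ℂ] X} (hD : M.IsDerivation D) :
    M.IsApproxInner ℕ D := by
  obtain ⟨x, hx⟩ := h X M D hD
  obtain ⟨K, -, hK⟩ := exists_bound_of_tendsto hx
  exact ⟨x, hx, K, hK⟩

variable [IsScalarTower ℂ A A] [SMulCommClass ℂ A A] [CompleteSpace A]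

open ProjTensor

/-- If derivations are boundedly approximately inner along `κ`, then `A` has a bounded approximate
diagonal along `κ`, and a bounded approximate identity. -/
theorem exists_approxDiagonal_and_hasBoundedApproxIdentity {κ : Type*} [TopologicalSpace κ]
    [DiscreteTopology κ] [Preorder κ] [IsDirectedOrder κ] [Nonempty κ] {ε : κ → ℝ}
    (hε : ∀ k, 0 < ε k) (hε0 : Tendsto ε atTop (𝓝 0))
    (h1 : (unitizedBimodule (A := A)).IsApproxInner κ (unitizedDerivation A (ProjTensor A)))
    (h2 : ∀ D, (bimodule.vanishingFamilies κ (mulMap (A := A)) mulMap_leftMul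
        mulMap_rightMul).IsDerivation D →
      (bimodule.vanishingFamilies κ (mulMap (A := A)) mulMap_leftMul
        mulMap_rightMul).IsApproxInner κ D) :
    (∃ u : κ → ProjTensor A, IsApproxDiagonal u ∧ ∃ K : ℝ, 0 < K ∧ ∀ i (a : A),
      ‖leftMul a (u i) - rightMul a (u i)‖ ≤ K * ‖a‖ ∧ ‖mulMap (u i) * a‖ ≤ K * ‖a‖) ∧
    HasBoundedApproxIdentity A := by
  obtain ⟨e, ⟨C, hC⟩, he⟩ := exists_boundedApproxIdentity hε hε0 h1
  exact ⟨exists_approxDiagonal hε hε0 hC he h2, hasBoundedApproxIdentity_of_tendsto hC he⟩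

theorem IsBoundedlyApproxContractible.isBoundedlyPseudoAmenable_and
    (h : IsBoundedlyApproxContractible A) :
    IsBoundedlyPseudoAmenable A ∧ HasBoundedApproxIdentity A := by
  classical
  -- with the discrete topology, bounded families are bounded continuous functions
  let _ : TopologicalSpace (Finset A × ℕ) := ⊥
  have _ : DiscreteTopology (Finset A × ℕ) := ⟨rfl⟩
  have := (BanachBimodule.isClosed_vanishing (Finset A × ℕ)
    (mulMap (A := A))).completeSpace_coe
  obtain ⟨⟨u, hu⟩, he⟩ := exists_approxDiagonal_and_hasBoundedApproxIdentity (A := A)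
    (ε := fun p : Finset A × ℕ => 1 / ((p.2 : ℝ) + 1)) (fun _ => Nat.one_div_pos_of_nat)
    (tendsto_one_div_finset_prod_nat A)
    (h.isApproxInner (isDerivation_unitizedDerivation _ _ _ _)) fun D hD => h.isApproxInner hD
  exact ⟨⟨Finset A × ℕ, inferInstance, inferInstance, inferInstance, u, hu⟩, he⟩

theorem IsSequentiallyApproxContractible.isSequentiallyPseudoAmenable_and
    (h : IsSequentiallyApproxContractible A) :
    IsSequentiallyPseudoAmenable A ∧ HasBoundedApproxIdentity A := by
  have := (BanachBimodule.isClosed_vanishing ℕ (mulMap (A := A))).completeSpace_coe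
  obtain ⟨⟨u, hu, -⟩, he⟩ := exists_approxDiagonal_and_hasBoundedApproxIdentity (A := A)
    (fun n : ℕ => Nat.one_div_pos_of_nat) tendsto_one_div_add_atTop_nhds_zero_nat
    (h.isApproxInner (isDerivation_unitizedDerivation _ _ _ _)) fun D hD => h.isApproxInner hD
  exact ⟨⟨u, hu⟩, he⟩

theorem IsBoundedlyPseudoAmenable.isBoundedlyApproxContractible
    (h : IsBoundedlyPseudoAmenable A) (he : HasBoundedApproxIdentity A) :
    IsBoundedlyApproxContractible A := by
  classical
  intro X _ _ _ M D hD
  obtain ⟨ι, _, _, _, u, hu, K, hK0, hK⟩ := h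
  obtain ⟨ι', _, _, _, e, ⟨C, hC⟩, he⟩ := he
  obtain ⟨r, hr⟩ := exists_reindex
    (f := fun a i => ‖leftMul a (u i) - rightMul a (u i)‖ + ‖mulMap (u i) * a - a‖) fun a => by
      simpa using (tendsto_zero_iff_norm_tendsto_zero.mp (hu a).1).add
        (tendsto_iff_norm_sub_tendsto_zero.mp (hu a).2)
  have hu' : IsApproxDiagonal (u ∘ r) := fun a =>
    ⟨squeeze_zero_norm (fun _ => le_add_of_nonneg_right (norm_nonneg _)) (hr a),
      tendsto_iff_norm_sub_tendsto_zero.mpr (squeeze_zero (fun _ => norm_nonneg _)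
        (fun _ => le_add_of_nonneg_left (norm_nonneg _)) (hr a))⟩
  obtain ⟨x, hx, L, hL⟩ := BanachBimodule.isApproxInner_of_isApproxDiagonal
    (ε := fun p : Finset A × ℕ => 1 / ((p.2 : ℝ) + 1)) (fun _ => Nat.one_div_pos_of_nat)
    (tendsto_one_div_finset_prod_nat A) hu' hK0.le (fun k => hK (r k)) hC (fun a => (he a).2) hD
  exact ⟨Finset A × ℕ, inferInstance, inferInstance, inferInstance, x, hx, max L 0, fun k =>
    ContinuousLinearMap.opNorm_le_bound _ (le_max_right _ _) fun a =>
      (hL k a).trans (by gcongr; exact le_max_left _ _)⟩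

theorem IsSequentiallyPseudoAmenable.isSequentiallyApproxContractible
    (h : IsSequentiallyPseudoAmenable A) (he : HasBoundedApproxIdentity A) :
    IsSequentiallyApproxContractible A := by
  intro X _ _ _ M D hD
  obtain ⟨u, hu⟩ := h
  obtain ⟨ι', _, _, _, e, ⟨C, hC⟩, he⟩ := he
  obtain ⟨K₁, hK₁0, hK₁⟩ := exists_bound_of_tendsto
    (g := fun n => bimodule.ad (u n)) (y := 0) fun a => (hu a).1
  obtain ⟨K₂, -, hK₂⟩ := exists_bound_of_tendsto
    (g := fun n => ContinuousLinearMap.mul ℂ A (mulMap (u n))) (y := id) fun a => (hu a).2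
  obtain ⟨x, hx, -⟩ := BanachBimodule.isApproxInner_of_isApproxDiagonal
    (fun n : ℕ => Nat.one_div_pos_of_nat) tendsto_one_div_add_atTop_nhds_zero_nat hu
    (hK₁0.trans (le_max_left K₁ K₂))
    (fun n a => ⟨(hK₁ n a).trans (by gcongr; exact le_max_left _ _),
      (hK₂ n a).trans (by gcongr; exact le_max_right _ _)⟩) hC (fun a => (he a).2) hD
  exact ⟨x, hx⟩

end

end

theorem mainTheorem1 (A : Type u) [NonUnitalNormedRing A] [NormedSpace ℂ A]
    [IsScalarTower ℂ A A] [SMulCommClass ℂ A A] [CompleteSpace A] :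
    (IsBoundedlyApproxContractible A ↔
      IsBoundedlyPseudoAmenable A ∧ HasBoundedApproxIdentity A) ∧
    (IsSequentiallyApproxContractible A ↔
      IsSequentiallyPseudoAmenable A ∧ HasBoundedApproxIdentity A) :=
  ⟨⟨fun h => h.isBoundedlyPseudoAmenable_and, fun h => h.1.isBoundedlyApproxContractible h.2⟩,
    ⟨fun h => h.isSequentiallyPseudoAmenable_and,
      fun h => h.1.isSequentiallyApproxContractible h.2⟩⟩
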